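/- **Theorem (exponential fast-forwarding of number-conserving quadratic bosonic Hamiltonians).** *Setting.* Let $\mathcal H_n$ be the bosonic Fock space of $n$ modes with annihilation and creation operators $c_i, c_i^\dagger$, and let $\mathcal S_m\subseteq\mathcal H_n$ be the subspace with exactly $m$ bosons in total. A bosonic operator is a finite sum of terms $a\,(c_{i_1}^\dagger)^{e_1}\cdots(c_{i_k}^\dagger)^{e_k}c_{j_1}^{f_1}\cdots c_{j_l}^{f_l}$ with $a\in\mathbb C$, distinct modes $i_1,\dots,i_k$, distinct modes $j_1,\dots,j_l$ and all $e_r,f_r\ge 1$; its weight is the largest $k+l$, and its degree the largest $\sum e_r+\sum f_r$, over its terms. Fix constants $w,d\ge 2$ and $w',d'\ge 2$. An elementary gate of the bosonic model is $e^{-i\theta O}$ with $|\theta|\le 1$, where $O$ is an (essentially) self-adjoint bosonic operator that involves at most $w$ modes, has weight at most $w$, degree at most $d$, and coefficients $|a|\le 1$. A circuit is a sequence of such gates on the $n$ modes and finitely many ancillary modes; its complexity is the number of gates. Circuits $\{V_n(t)\}$ simulate $\{H_n\}$ on subspaces $\mathcal S_n$ with parameters $(T(n),\epsilon,G(n))$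 if, for all $n$ and all $0\le t\le T(n)$, $V_n(t)$ has complexity at most $G(n)$ and $\|(e^{-itH_n}\otimes 1-V_n(t))\,|\psi\rangle\otimes|0\rangle\|\le\epsilon$ for all unit vectors $|\psi\rangle\in\mathcal S_n$, where $|0\rangle$ is the vacuum of the ancillary modes. Let $\mathcal C_n$ be the class of Hermitian, number-conserving bosonic Hamiltonians on $n$ modes of weight at most $w'$, degree at most $d'$, and coefficients $|a|\le 1$. The no-fast-forwarding line is $l(n)=\sup_{H\in\mathcal C_n}\min G$, the minimum being over all $G$ such that some circuits simulate $H$ (on the same subspaces) with parameters $(T(n),\epsilon,G)$. The circuits $\{V_n(t)\}$ are $(T(n),\epsilon,G(n))$-fast-forwarding $\{H_n\in\mathcal C_n\}$ if they simulate $\{H_n\}$ with these parameters and $G(n)/l(n)\to 0$. The fast-forwarding is exponential if moreover $G(n)=\mathrm{poly}(n)$ while $l(n)$ grows at least exponentially. *Statement.* For each $n$ let $$H_n=\sum_{i,j=1}^n\alpha^{(n)}_{ij}c_i^\dagger c_j,\qquad |\alpha^{(n)}_{ij}|\le 1,\quad \alpha^{(n)}_{ji}=\overline{\alpha^{(n)}_{ij}}$$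 (in particular, any such $H_n\in\mathfrak{su}(n)$, i.e. with $\sum_i\alpha^{(n)}_{ii}=0$). Let $\epsilon>0$, let $T(n)=\tau^n$ with $\tau>1$, and let $m(n)\in\mathbb N$ be bounded by a polynomial in $n$. Then $H_n\in\mathcal C_n$, and there exist circuits $\{V_n(t)\}_{n,t}$ in the bosonic gate model that simulate $\{H_n\}$ on the subspaces $\{\mathcal S_{m(n)}\}$ with parameters $(T(n),\epsilon,G(n))$, where $G(n)=O(n^2\log T(n))$, and thus $G(n)=\mathrm{poly}(n)$. Moreover, if $l(n)=\Omega(nT(n))$, these circuits are $(T(n),\epsilon,G(n))$-fast-forwarding $\{H_n\}$ on $\{\mathcal S_{m(n)}\}$ relative to $\{\mathcal C_n\}$, and the fast-forwarding is exponential. -/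

import Mathlib

open scoped ENNReal

namespace Bosonic

/-! ### Fock space and the canonical operators -/

/-- Occupation numbers of `N` bosonic modes. -/
abbrev Occ (N : ℕ) : Type := Fin N → ℕ

/-- The bosonic Fock space of `N` modes in the occupation-number representation: square-summable
complex amplitudes indexed by the occupation numbers. -/
abbrev Fock (N : ℕ) : Type := lp (fun _ : Occ N => ℂ) 2

/-- The algebraic core of Fock space: finite linear combinations of number states. All polynomials
in the creation and annihilation operators act on it, and leave it invariant. -/
abbrev Core (N : ℕ) : Type := Occ N →₀ ℂ

/-- The creation operator `c_i†`, `c_i† |x⟩ = √(x_i + 1) |x + e_i⟩`. -/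
noncomputable def create {N : ℕ} (i : Fin N) : Module.End ℂ (Core N) :=
  Finsupp.linearCombination ℂ fun x : Occ N =>
    Finsupp.single (x + Pi.single i 1) ((Real.sqrt (x i + 1) : ℝ) : ℂ)

/-- The annihilation operator `c_i`, `c_i |x⟩ = √(x_i) |x - e_i⟩` (which is `0` if `x_i = 0`). -/
noncomputable def annihilate {N : ℕ} (i : Fin N) : Module.End ℂ (Core N) :=
  Finsupp.linearCombination ℂ fun x : Occ N =>
    Finsupp.single (x - Pi.single i 1) ((Real.sqrt (x i) : ℝ) : ℂ)

/-- The inclusion of the core into Fock space, mapping basis vectors to number states. -/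
noncomputable def incl (N : ℕ) : Core N →ₗ[ℂ] Fock N :=
  Finsupp.linearCombination ℂ fun x : Occ N => lp.single 2 x (1 : ℂ)

/-- The subspace of Fock space with `m` bosons in total. -/
def sector (N m : ℕ) : Submodule ℂ (Fock N) where
  carrier := {ψ | ∀ x : Occ N, ∑ i, x i ≠ m → ψ x = 0}
  add_mem' := by
    intro a b ha hb x hx
    simp [ha x hx, hb x hx]
  zero_mem' := by
    intro x _
    simp
  smul_mem' := by
    intro c a ha x hx
    simp [ha x hx]

/-! ### Bosonic operators -/

/-- Coefficients of a bosonic operator: `p (e, f)` is the coefficient of the normally ordered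
monomial `(c_1†)^{e_1} ⋯ (c_N†)^{e_N} c_1^{f_1} ⋯ c_N^{f_N}`. -/
abbrev Op (N : ℕ) : Type := (Occ N × Occ N) →₀ ℂ

/-- The monomial `(c_1†)^{e_1} ⋯ (c_N†)^{e_N} c_1^{f_1} ⋯ c_N^{f_N}` on the core. -/
noncomputable def monomial {N : ℕ} (e f : Occ N) : Module.End ℂ (Core N) :=
  (List.ofFn fun i => create i ^ e i).prod * (List.ofFn fun i => annihilate i ^ f i).prod

/-- The action of a bosonic operator on the core. -/
noncomputable def Op.toEnd {N : ℕ} (p : Op N) : Module.End ℂ (Core N) :=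
  p.sum fun ef a => a • monomial ef.1 ef.2

/-- Formally Hermitian: the coefficient of the adjoint monomial is the complex conjugate. -/
def Op.Hermitian {N : ℕ} (p : Op N) : Prop :=
  ∀ e f : Occ N, p (f, e) = (starRingEnd ℂ) (p (e, f))

/-- Every term contains as many creation as annihilation operators. -/
def Op.NumberConserving {N : ℕ} (p : Op N) : Prop :=
  ∀ ef ∈ p.support, ∑ i, ef.1 i = ∑ i, ef.2 i

/-- All coefficients have modulus at most one. -/
def Op.Normalized {N : ℕ} (p : Op N) : Prop :=
  ∀ ef, ‖p ef‖ ≤ 1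

/-- In every term, the number of modes that are created plus the number of modes that are
annihilated is at most `w`. -/
def Op.WeightLE {N : ℕ} (p : Op N) (w : ℕ) : Prop :=
  ∀ ef ∈ p.support,
    (Finset.univ.filter fun i => ef.1 i ≠ 0).card
      + (Finset.univ.filter fun i => ef.2 i ≠ 0).card ≤ w

/-- In every term, the sum of all exponents is at most `d`. -/
def Op.DegreeLE {N : ℕ} (p : Op N) (d : ℕ) : Prop :=
  ∀ ef ∈ p.support, ∑ i, ef.1 i + ∑ i, ef.2 i ≤ d

/-- The operator only involves modes in `I`. -/
def Op.ActsOn {N : ℕ} (p : Op N) (I : Finset (Fin N)) : Prop :=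
  ∀ ef ∈ p.support, ∀ i, i ∉ I → ef.1 i = 0 ∧ ef.2 i = 0

/-- The number-conserving quadratic operator `∑ i j, α i j • c_i† c_j`. -/
noncomputable def quadratic {N : ℕ} (α : Matrix (Fin N) (Fin N) ℂ) : Op N :=
  ∑ i, ∑ j, Finsupp.single (Pi.single i 1, Pi.single j 1) (α i j)

/-! ### Unitary evolution -/

/-- `U` is a strongly continuous one-parameter unitary group whose generator extends `-i A`. By
Stone's theorem such `U` correspond to the self-adjoint extensions `B ⊇ A`, via `U t = e^{-itB}`. -/
structure IsEvolution {N : ℕ} (A : Module.End ℂ (Core N))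
    (U : ℝ → (Fock N ≃ₗᵢ[ℂ] Fock N)) : Prop where
  zero : U 0 = 1
  add : ∀ s t, U (s + t) = U s * U t
  continuous : ∀ ψ, Continuous fun t => U t ψ
  deriv : ∀ v : Core N, HasDerivAt (fun t => U t (incl N v)) (-Complex.I • incl N (A v)) 0

/-- `A` is essentially self-adjoint on the core: it has exactly one self-adjoint extension, that is,
it generates exactly one unitary group. -/
def IsEssSelfAdjoint {N : ℕ} (A : Module.End ℂ (Core N)) : Prop :=
  ∃! U : ℝ → (Fock N ≃ₗᵢ[ℂ] Fock N), IsEvolution A U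

open Classical in
/-- The unitary `e^{-itA}`, for `A` essentially self-adjoint (and `1` by convention otherwise). -/
noncomputable def evolution {N : ℕ} (A : Module.End ℂ (Core N)) (t : ℝ) : Fock N ≃ₗᵢ[ℂ] Fock N :=
  if h : IsEssSelfAdjoint A then h.choose t else 1

/-! ### The bosonic gate model -/

/-- An elementary gate `e^{-iθO}` of the bosonic model with constants `w` and `d`: here `|θ| ≤ 1`
and `O` is a self-adjoint bosonic operator on at most `w` modes, of weight at most `w` and degree
at most `d`, with coefficients of modulus at most one. -/
structure Gate (w d N : ℕ) where
  /-- the observable -/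
  O : Op N
  /-- the angle -/
  θ : ℝ
  abs_le : |θ| ≤ 1
  hermitian : O.Hermitian
  normalized : O.Normalized
  weight_le : O.WeightLE w
  degree_le : O.DegreeLE d
  acts_on : ∃ I : Finset (Fin N), I.card ≤ w ∧ O.ActsOn I
  ess_self_adjoint : IsEssSelfAdjoint O.toEnd

/-- The unitary of an elementary gate. -/
noncomputable def Gate.unitary {w d N : ℕ} (g : Gate w d N) : Fock N ≃ₗᵢ[ℂ] Fock N :=
  evolution g.O.toEnd g.θ

/-- A quantum circuit for a system of `n` modes: a sequence of elementary gates that act on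
these modes and on `anc` ancillary modes. -/
structure Circuit (w d n : ℕ) where
  /-- the number of ancillary modes -/
  anc : ℕ
  /-- the gates -/
  gates : List (Gate w d (n + anc))

/-- The unitary of a circuit. -/
noncomputable def Circuit.unitary {w d n : ℕ} (V : Circuit w d n) :
    Fock (n + V.anc) ≃ₗᵢ[ℂ] Fock (n + V.anc) :=
  (V.gates.map Gate.unitary).prod

/-- The quantum complexity of a circuit: its number of gates. -/
def Circuit.size {w d n : ℕ} (V : Circuit w d n) : ℕ := V.gates.length

/-- Amplitudes of `|ψ⟩ ⊗ |0⟩`, where the last `a` modes are in the vacuum. -/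
noncomputable def withVacuumFun {n : ℕ} (a : ℕ) (ψ : Fock n) (x : Occ (n + a)) : ℂ :=
  if ∀ j : Fin a, x (Fin.natAdd n j) = 0 then ψ fun i => x (Fin.castAdd a i) else 0

theorem withVacuumFun_memℓp {n : ℕ} (a : ℕ) (ψ : Fock n) : Memℓp (withVacuumFun a ψ) 2 := by
  have h := (lp.memℓp ψ).summable (by norm_num)
  refine memℓp_gen ?_
  let g : Occ n → Occ (n + a) := fun y => Fin.append y 0
  have hg : Function.Injective g := by
    intro y z hyz
    funext i
    have := congrFun hyz (Fin.castAdd a i)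
    simpa [g] using this
  refine (hg.summable_iff ?_).1 ?_
  · intro x hx
    have : ¬ ∀ j : Fin a, x (Fin.natAdd n j) = 0 := by
      intro h0
      refine hx ⟨fun i => x (Fin.castAdd a i), ?_⟩
      funext k
      refine Fin.addCases (fun i => ?_) (fun j => ?_) k
      · simp [g]
      · simp [g, h0 j]
    simp [withVacuumFun, this]
  · convert h using 2 with y
    simp [withVacuumFun, g]

/-- The state `|ψ⟩ ⊗ |0⟩` of `n + a` modes, where the last `a` modes are in the vacuum. -/
noncomputable def withVacuum {n : ℕ} (a : ℕ) (ψ : Fock n) : Fock (n + a) :=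
  ⟨withVacuumFun a ψ, withVacuumFun_memℓp a ψ⟩

/-! ### Hamiltonian simulation and fast-forwarding -/

/-- The circuits `V t` simulate `H` on the subspace `S` with parameters `(T, ε, G)`. -/
def Simulates {w d n : ℕ} (V : ℝ → Circuit w d n) (H : Op n) (S : Submodule ℂ (Fock n))
    (T ε : ℝ) (G : ℕ) : Prop :=
  ∀ t : ℝ, 0 ≤ t → t ≤ T →
    (V t).size ≤ G ∧
    ∀ ψ ∈ S, ‖ψ‖ = 1 →
      ‖withVacuum (V t).anc (evolution H.toEnd t ψ)
        - (V t).unitary (withVacuum (V t).anc ψ)‖ ≤ ε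

/-- The class of `n`-mode number-conserving bosonic Hamiltonians of weight at most `w` and degree at
most `d`, with coefficients of modulus at most one. -/
def hamiltonianClass (w d n : ℕ) : Set (Op n) :=
  {H | H.Hermitian ∧ H.NumberConserving ∧ H.Normalized ∧ H.WeightLE w ∧ H.DegreeLE d ∧
    IsEssSelfAdjoint H.toEnd}

/-- The no-fast-forwarding line at a fixed `n`, in the gate model with constants `w`, `d`: the
largest, over the Hamiltonians of the class `C`, of the least complexity of simulation (infinite
if there is no bound). -/
noncomputable def noFastForwardingLine (w d : ℕ) {n : ℕ} (C : Set (Op n))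
    (S : Submodule ℂ (Fock n)) (T ε : ℝ) : ℕ∞ :=
  ⨆ H ∈ C, ⨅ (V : ℝ → Circuit w d n) (G : ℕ) (_ : Simulates V H S T ε G), (G : ℕ∞)

/-- The circuits `V` are `(T, ε, G)`-fast-forwarding the sequence `H n ∈ C n` on the subspaces `S n`
relative to the classes `C n`. -/
def FastForwards {w d : ℕ} (V : (n : ℕ) → ℝ → Circuit w d n) (C : (n : ℕ) → Set (Op n))
    (H : (n : ℕ) → Op n) (S : (n : ℕ) → Submodule ℂ (Fock n))
    (T : ℕ → ℝ) (ε : ℝ) (G : ℕ → ℕ) : Prop :=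
  (∀ n, H n ∈ C n) ∧
  (∀ n, Simulates (V n) (H n) (S n) (T n) ε (G n)) ∧
  Filter.Tendsto
    (fun n => (G n : ℝ≥0∞) / ((noFastForwardingLine w d (C n) (S n) (T n) ε : ℕ∞) : ℝ≥0∞))
    Filter.atTop (nhds 0)

/-- Bounded by a polynomial. -/
def PolyBounded (f : ℕ → ℕ) : Prop :=
  ∃ P : Polynomial ℕ, ∀ n, f n ≤ P.eval n

/-- Exponential fast-forwarding: fast-forwarding with polynomially many gates, where the
no-fast-forwarding line grows at least exponentially. -/
def ExpFastForwards {w d : ℕ} (V : (n : ℕ) → ℝ → Circuit w d n) (C : (n : ℕ) → Set (Op n))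
    (H : (n : ℕ) → Op n) (S : (n : ℕ) → Submodule ℂ (Fock n))
    (T : ℕ → ℝ) (ε : ℝ) (G : ℕ → ℕ) : Prop :=
  FastForwards V C H S T ε G ∧
  PolyBounded G ∧
  ∃ b : ℝ, 1 < b ∧ ∀ᶠ n in Filter.atTop,
    ENNReal.ofReal (b ^ n) ≤ ((noFastForwardingLine w d (C n) (S n) (T n) ε : ℕ∞) : ℝ≥0∞)

end Bosonic

namespace Bosonic

/-! The evolution generated by a quadratic number-conserving Hamiltonian is the second quantization
of the `n × n` unitary `e^{-itα}`. However large `t` is, this matrix is just one element of `U(n)`,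
and any such element is a product of `O(n²)` phases and two-mode rotations. Since second
quantization is multiplicative, the same factorization yields a circuit that is exact on all of Fock
space, needs no ancillas, and has at most `16 n²` gates, uniformly in `t`. With `log T = n log τ`,
the bound `O(n² log T)` and the comparison with a line of order `n T` are elementary asymptotics.

The analytic work is to identify `e^{-itH}`, which is defined through uniqueness of the unitary
group. In the Bargmann picture `c_i†` is multiplication by `X_i`, `c_i` is `∂_i`, and a mode change
is a linear substitution of variables. `inner_linearSubst` makes the substitution by a unitary
matrix isometric, `IsModeEvolution.isEvolution` gives existence, and
`IsModeEvolution.eq_secondQuant` gives uniqueness. These serve both the Hamiltonian and the gates,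
so circuit identities become matrix identities, settled by `implementable_of_fixes_compl`. -/

/-! ### Number states; creation and annihilation as formal adjoints -/

theorem incl_single {N : ℕ} (x : Occ N) (a : ℂ) :
    incl N (Finsupp.single x a) = a • lp.single 2 x (1 : ℂ) := by
  simp [incl]

theorem incl_apply {N : ℕ} (v : Core N) (x : Occ N) : incl N v x = v x := by
  induction v using Finsupp.induction_linear with
  | zero => simp
  | add f g hf hg => simp [hf, hg]
  | single y a =>
    rw [incl_single]
    by_cases h : y = x
    · subst h; simp
    · simp [lp.single_apply, Ne.symm h]

theorem inner_incl_single_left {N : ℕ} (x : Occ N) (a : ℂ) (w : Core N) :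
    inner ℂ (incl N (Finsupp.single x a)) (incl N w) = (starRingEnd ℂ) a * w x := by
  rw [incl_single, inner_smul_left, lp.inner_single_left, incl_apply]
  simp

theorem denseRange_incl (N : ℕ) : DenseRange (incl N) := by
  intro ψ
  have h := lp.hasSum_single (p := 2) (by norm_num) ψ
  refine mem_closure_of_tendsto h (Filter.Eventually.of_forall fun s => ?_)
  refine ⟨∑ x ∈ s, Finsupp.single x (ψ x), ?_⟩
  rw [map_sum]
  refine Finset.sum_congr rfl fun x _ => ?_
  rw [incl_single, ← lp.single_smul]
  simp

theorem create_single {N : ℕ} (i : Fin N) (x : Occ N) (a : ℂ) :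
    create i (Finsupp.single x a) =
      Finsupp.single (x + Pi.single i 1) (a * ((Real.sqrt (x i + 1) : ℝ) : ℂ)) := by
  simp [create]

theorem annihilate_single {N : ℕ} (i : Fin N) (x : Occ N) (a : ℂ) :
    annihilate i (Finsupp.single x a) =
      Finsupp.single (x - Pi.single i 1) (a * ((Real.sqrt (x i) : ℝ) : ℂ)) := by
  simp [annihilate]

theorem inner_create_left {N : ℕ} (i : Fin N) (v w : Core N) :
    inner ℂ (incl N (create i v)) (incl N w) = inner ℂ (incl N v) (incl N (annihilate i w)) := by
  induction v using Finsupp.induction_linear with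
  | zero => simp
  | add f g hf hg => simp only [map_add, inner_add_left, hf, hg]
  | single x a =>
    rw [create_single, inner_incl_single_left, inner_incl_single_left, map_mul, Complex.conj_ofReal,
      mul_assoc]
    congr 1
    induction w using Finsupp.induction_linear with
    | zero => simp
    | add f g hf hg => simp only [map_add, Finsupp.add_apply, mul_add, hf, hg]
    | single y b =>
      rw [annihilate_single, Finsupp.single_apply, Finsupp.single_apply]
      by_cases h : y = x + Pi.single i 1
      · subst h
        simp [mul_comm]
      · rw [if_neg h]
        -- Truncated subtraction may send an empty mode to a wrong basis vector; the factor `√0`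
        -- then kills the term.
        by_cases hy : y i = 0
        · simp [hy]
        · rw [if_neg]
          · simp
          · rintro rfl
            apply h
            funext k
            by_cases hk : k = i
            · subst hk; simp; omega
            · simp [hk]

/-! ### The Bargmann representation on polynomials -/

/-- The square root of the product of the factorials of the occupation numbers. -/
noncomputable def sqrtFactorial {N : ℕ} (x : Occ N) : ℝ := Real.sqrt (∏ i, ((x i).factorial : ℝ))

theorem sqrtFactorial_ne_zero {N : ℕ} (x : Occ N) : sqrtFactorial x ≠ 0 := by
  refine (Real.sqrt_pos.2 (Finset.prod_pos fun i _ => ?_)).ne'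
  exact_mod_cast Nat.factorial_pos _

theorem sqrtFactorial_add_single {N : ℕ} (i : Fin N) (x : Occ N) :
    sqrtFactorial (x + Pi.single i 1) = sqrtFactorial x * Real.sqrt (x i + 1) := by
  unfold sqrtFactorial
  rw [← Real.sqrt_mul (Finset.prod_nonneg fun i _ => by positivity)]
  congr 1
  rw [← Finset.mul_prod_erase _ _ (Finset.mem_univ i), ← Finset.mul_prod_erase (a := i) _
    (fun j => ((x j).factorial : ℝ)) (Finset.mem_univ i)]
  have : ∀ j ∈ Finset.univ.erase i,
      (((x + Pi.single i 1 : Occ N) j).factorial : ℝ) = ((x j).factorial : ℝ) := by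
    intro j hj
    simp [Finset.ne_of_mem_erase hj]
  rw [Finset.prod_congr rfl this]
  simp [Nat.factorial_succ]
  ring

theorem sqrtFactorial_sub_single {N : ℕ} (i : Fin N) (x : Occ N) :
    sqrtFactorial x * Real.sqrt (x i) = x i * sqrtFactorial (x - Pi.single i 1) := by
  by_cases h : x i = 0
  · simp [h]
  · obtain ⟨y, rfl⟩ : ∃ y : Occ N, x = y + Pi.single i 1 := by
      refine ⟨x - Pi.single i 1, ?_⟩
      funext k
      by_cases hk : k = i
      · subst hk; simp; omega
      · simp [hk]
    rw [sqrtFactorial_add_single, add_tsub_cancel_right, mul_assoc]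
    simp only [Pi.add_apply, Pi.single_eq_same, Nat.cast_add, Nat.cast_one]
    rw [Real.mul_self_sqrt (by positivity)]
    ring

/-- The Bargmann representation: polynomials as finite combinations of number states. -/
noncomputable def bargmann (N : ℕ) : MvPolynomial (Fin N) ℂ ≃ₗ[ℂ] Core N :=
  (MvPolynomial.basisMonomials (Fin N) ℂ).equiv
    -- The weight `√(x!)` absorbs the square roots in the ladder operators, leaving plain
    -- multiplication and differentiation.
    ((Finsupp.basisSingleOne (R := ℂ) (ι := Occ N)).isUnitSMul
      (w := fun x => ((sqrtFactorial x : ℝ) : ℂ))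
      fun x => isUnit_iff_ne_zero.2 (by exact_mod_cast sqrtFactorial_ne_zero x))
    Finsupp.equivFunOnFinite

theorem bargmann_monomial {N : ℕ} (s : Fin N →₀ ℕ) (a : ℂ) :
    bargmann N (MvPolynomial.monomial s a) = Finsupp.single (⇑s) (a * (sqrtFactorial s : ℂ)) := by
  have h : MvPolynomial.monomial s a = a • MvPolynomial.basisMonomials (Fin N) ℂ s := by
    simp [MvPolynomial.smul_monomial]
  rw [h, map_smul, bargmann, Module.Basis.equiv_apply, Module.Basis.isUnitSMul_apply,
    Finsupp.coe_basisSingleOne, Finsupp.smul_single, Finsupp.smul_single, smul_eq_mul, smul_eq_mul,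
    mul_one]
  rfl

theorem coe_add_single {N : ℕ} (s : Fin N →₀ ℕ) (i : Fin N) :
    (⇑(s + Finsupp.single i 1 : Fin N →₀ ℕ) : Occ N) = ⇑s + Pi.single i 1 := by
  rw [Finsupp.coe_add, Finsupp.single_eq_pi_single]

theorem coe_sub_single {N : ℕ} (s : Fin N →₀ ℕ) (i : Fin N) :
    (⇑(s - Finsupp.single i 1 : Fin N →₀ ℕ) : Occ N) = ⇑s - Pi.single i 1 := by
  rw [Finsupp.coe_tsub, Finsupp.single_eq_pi_single]

theorem create_bargmann {N : ℕ} (i : Fin N) (p : MvPolynomial (Fin N) ℂ) :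
    create i (bargmann N p) = bargmann N (p * MvPolynomial.X i) := by
  induction p using MvPolynomial.induction_on' with
  | monomial s a =>
    rw [← pow_one (MvPolynomial.X i), MvPolynomial.X_pow_eq_monomial, MvPolynomial.monomial_mul,
      bargmann_monomial, bargmann_monomial, create_single, coe_add_single,
      sqrtFactorial_add_single]
    push_cast
    rw [mul_one, mul_assoc]
  | add p q hp hq => simp only [map_add, add_mul, hp, hq]

theorem annihilate_bargmann {N : ℕ} (i : Fin N) (p : MvPolynomial (Fin N) ℂ) :
    annihilate i (bargmann N p) = bargmann N (MvPolynomial.pderiv i p) := by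
  induction p using MvPolynomial.induction_on' with
  | monomial s a =>
    rw [MvPolynomial.pderiv_monomial, bargmann_monomial, bargmann_monomial, annihilate_single,
      coe_sub_single, mul_assoc, mul_assoc]
    congr 2
    exact_mod_cast sqrtFactorial_sub_single i (⇑s : Occ N)
  | add p q hp hq => simp only [map_add, hp, hq]

/-- Multiplication by a variable is adjoint to differentiation. -/
theorem inner_bargmann_mul_X {N : ℕ} (i : Fin N) (p q : MvPolynomial (Fin N) ℂ) :
    inner ℂ (incl N (bargmann N (p * MvPolynomial.X i))) (incl N (bargmann N q)) =
      inner ℂ (incl N (bargmann N p)) (incl N (bargmann N (MvPolynomial.pderiv i q))) := by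
  rw [← create_bargmann, inner_create_left, annihilate_bargmann]

theorem bargmann_apply {N : ℕ} (q : MvPolynomial (Fin N) ℂ) (s : Fin N →₀ ℕ) :
    bargmann N q ⇑s = q.coeff s * (sqrtFactorial s : ℂ) := by
  induction q using MvPolynomial.induction_on' with
  | monomial r a =>
    rw [bargmann_monomial, Finsupp.single_apply, MvPolynomial.coeff_monomial]
    by_cases h : r = s
    · simp [h]
    · rw [if_neg h, if_neg (fun h' => h (DFunLike.coe_injective h')), zero_mul]
  | add p q hp hq => simp only [map_add, Finsupp.add_apply, MvPolynomial.coeff_add, add_mul, hp, hq]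

/-- Constants are multiples of the vacuum, which is orthogonal to every other number state. Base
case of the isometry induction. -/
theorem inner_bargmann_C {N : ℕ} (a : ℂ) (q : MvPolynomial (Fin N) ℂ) :
    inner ℂ (incl N (bargmann N (MvPolynomial.C a))) (incl N (bargmann N q)) =
      (starRingEnd ℂ) a * MvPolynomial.constantCoeff q := by
  rw [← MvPolynomial.monomial_zero', bargmann_monomial, inner_incl_single_left, bargmann_apply,
    MvPolynomial.constantCoeff_eq]
  simp [sqrtFactorial]

/-! ### Second quantization of unitary mode changes -/

/-- The algebra homomorphism induced by a linear change of the variables. -/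
noncomputable def linearSubst {N : ℕ} (u : Matrix (Fin N) (Fin N) ℂ) :
    MvPolynomial (Fin N) ℂ →ₐ[ℂ] MvPolynomial (Fin N) ℂ :=
  MvPolynomial.aeval fun j => ∑ i, u i j • MvPolynomial.X i

theorem linearSubst_X {N : ℕ} (u : Matrix (Fin N) (Fin N) ℂ) (j : Fin N) :
    linearSubst u (MvPolynomial.X j) = ∑ i, u i j • MvPolynomial.X i := by
  simp [linearSubst]

theorem linearSubst_one (N : ℕ) : linearSubst (1 : Matrix (Fin N) (Fin N) ℂ) = AlgHom.id ℂ _ := by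
  refine MvPolynomial.algHom_ext fun j => ?_
  rw [linearSubst_X]
  simp [Matrix.one_apply]

theorem linearSubst_mul {N : ℕ} (u v : Matrix (Fin N) (Fin N) ℂ) :
    linearSubst (u * v) = (linearSubst u).comp (linearSubst v) := by
  refine MvPolynomial.algHom_ext fun j => ?_
  simp only [AlgHom.comp_apply, linearSubst_X, map_sum, map_smul, Matrix.mul_apply,
    Finset.sum_smul, Finset.smul_sum, smul_smul]
  rw [Finset.sum_comm]
  simp only [mul_comm]

theorem constantCoeff_linearSubst {N : ℕ} (u : Matrix (Fin N) (Fin N) ℂ)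
    (q : MvPolynomial (Fin N) ℂ) :
    MvPolynomial.constantCoeff (linearSubst u q) = MvPolynomial.constantCoeff q := by
  induction q using MvPolynomial.induction_on with
  | C a => simp [linearSubst]
  | add p q hp hq => simp only [map_add, hp, hq]
  | mul_X p i hp =>
    rw [map_mul, map_mul, linearSubst_X, map_mul, map_sum]
    simp [MvPolynomial.smul_eq_C_mul]

/-- The chain rule for a linear substitution. -/
theorem pderiv_linearSubst {N : ℕ} (u : Matrix (Fin N) (Fin N) ℂ) (i : Fin N)
    (q : MvPolynomial (Fin N) ℂ) :
    MvPolynomial.pderiv i (linearSubst u q) =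
      ∑ k, u i k • linearSubst u (MvPolynomial.pderiv k q) := by
  induction q using MvPolynomial.induction_on with
  | C a => simp [linearSubst]
  | add p q hp hq => simp only [map_add, hp, hq, smul_add, Finset.sum_add_distrib]
  | mul_X p j hp =>
    simp only [map_mul, Derivation.leibniz, hp, linearSubst_X, map_sum, Derivation.map_smul,
      MvPolynomial.pderiv_X, map_add, smul_add, Finset.sum_add_distrib, smul_eq_mul]
    congr 1
    · rw [Finset.sum_eq_single i, Finset.sum_eq_single j]
      · simp [mul_comm]
      · intro k _ hk
        simp [Ne.symm hk]
      · simp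
      · intro k _ hk
        simp [Ne.symm hk]
      · simp
    · rw [Finset.mul_sum]
      refine Finset.sum_congr rfl fun k _ => ?_
      rw [mul_smul_comm]

/-- By adjointness a variable removed from the left argument becomes a derivative on the right. The
chain rule carries this through the substitution, with `q` arbitrary in the induction. -/
theorem inner_linearSubst {N : ℕ} (u : Matrix.unitaryGroup (Fin N) ℂ)
    (p q : MvPolynomial (Fin N) ℂ) :
    inner ℂ (incl N (bargmann N (linearSubst u.1 p))) (incl N (bargmann N (linearSubst u.1 q))) =
      inner ℂ (incl N (bargmann N p)) (incl N (bargmann N q)) := by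
  induction p using MvPolynomial.induction_on generalizing q with
  | C a =>
    have : linearSubst u.1 (MvPolynomial.C a) = MvPolynomial.C a := by simp [linearSubst]
    rw [this, inner_bargmann_C, inner_bargmann_C, constantCoeff_linearSubst]
  | add p r hp hr => simp only [map_add, inner_add_left, hp, hr]
  | mul_X p i hp =>
    rw [inner_bargmann_mul_X, ← hp, map_mul, linearSubst_X, Finset.mul_sum]
    simp only [mul_smul_comm, map_sum, map_smul, sum_inner, inner_smul_left,
      inner_bargmann_mul_X, pderiv_linearSubst, inner_sum, inner_smul_right, Finset.mul_sum]
    rw [Finset.sum_comm]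
    -- Orthonormality of the columns of `u` collapses the double sum.
    have hu := congrFun₂ (Matrix.mem_unitaryGroup_iff'.1 u.2) i
    simp only [Matrix.mul_apply, Matrix.star_apply, RCLike.star_def] at hu
    simp only [← mul_assoc, ← Finset.sum_mul, hu]
    simp [Matrix.one_apply]

/-- The action of a unitary change of modes on the core. -/
noncomputable def coreAction {N : ℕ} (u : Matrix.unitaryGroup (Fin N) ℂ) : Core N ≃ₗ[ℂ] Core N :=
  ((bargmann N).symm.trans
    (AlgEquiv.ofAlgHom (linearSubst u.1) (linearSubst (star u.1))
      (by rw [← linearSubst_mul, Matrix.mem_unitaryGroup_iff.1 u.2, linearSubst_one])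
      (by rw [← linearSubst_mul, Matrix.mem_unitaryGroup_iff'.1 u.2,
        linearSubst_one])).toLinearEquiv).trans (bargmann N)

theorem coreAction_bargmann {N : ℕ} (u : Matrix.unitaryGroup (Fin N) ℂ)
    (p : MvPolynomial (Fin N) ℂ) :
    coreAction u (bargmann N p) = bargmann N (linearSubst u.1 p) := by
  simp [coreAction]

theorem coreAction_one {N : ℕ} (v : Core N) :
    coreAction (1 : Matrix.unitaryGroup (Fin N) ℂ) v = v := by
  obtain ⟨p, rfl⟩ := (bargmann N).surjective v
  rw [coreAction_bargmann, Matrix.UnitaryGroup.one_val, linearSubst_one, AlgHom.id_apply]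

theorem coreAction_mul {N : ℕ} (u u' : Matrix.unitaryGroup (Fin N) ℂ) (v : Core N) :
    coreAction (u * u') v = coreAction u (coreAction u' v) := by
  obtain ⟨p, rfl⟩ := (bargmann N).surjective v
  rw [coreAction_bargmann, coreAction_bargmann, coreAction_bargmann, Matrix.UnitaryGroup.mul_val,
    linearSubst_mul, AlgHom.comp_apply]

theorem norm_incl_coreAction {N : ℕ} (u : Matrix.unitaryGroup (Fin N) ℂ) (v : Core N) :
    ‖incl N (coreAction u v)‖ = ‖incl N v‖ := by
  obtain ⟨p, rfl⟩ := (bargmann N).surjective v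
  rw [coreAction_bargmann, @norm_eq_sqrt_re_inner ℂ, @norm_eq_sqrt_re_inner ℂ, inner_linearSubst]

/-- The second quantization of a unitary change of modes. -/
noncomputable def secondQuant {N : ℕ} (u : Matrix.unitaryGroup (Fin N) ℂ) :
    Fock N ≃ₗᵢ[ℂ] Fock N :=
  (coreAction u).extendOfIsometry (incl N) (incl N) (denseRange_incl N) (denseRange_incl N)
    (norm_incl_coreAction u)

theorem secondQuant_incl {N : ℕ} (u : Matrix.unitaryGroup (Fin N) ℂ) (v : Core N) :
    secondQuant u (incl N v) = incl N (coreAction u v) :=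
  LinearEquiv.extendOfIsometry_eq _ _ _ _ _ _ v

theorem isometryEquiv_ext {N : ℕ} {U V : Fock N ≃ₗᵢ[ℂ] Fock N}
    (h : ∀ v, U (incl N v) = V (incl N v)) : U = V := by
  refine LinearIsometryEquiv.ext fun ψ => ?_
  have := (denseRange_incl N).equalizer U.continuous V.continuous (funext h)
  exact congrFun this ψ

theorem secondQuant_one (N : ℕ) : secondQuant (1 : Matrix.unitaryGroup (Fin N) ℂ) = 1 :=
  isometryEquiv_ext fun v => by
    rw [secondQuant_incl, coreAction_one]
    rfl

theorem secondQuant_mul {N : ℕ} (u u' : Matrix.unitaryGroup (Fin N) ℂ) :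
    secondQuant (u * u') = secondQuant u * secondQuant u' :=
  isometryEquiv_ext fun v => by
    rw [secondQuant_incl, coreAction_mul, ← secondQuant_incl, ← secondQuant_incl]
    rfl

/-! ### Quadratic Hamiltonians as generators: existence of the evolution -/

theorem list_prod_ofFn_pow_single {N : ℕ} {M : Type*} [Monoid M] (f : Fin N → M) (i : Fin N) :
    (List.ofFn fun k => f k ^ (Pi.single i 1 : Occ N) k).prod = f i := by
  induction N with
  | zero => exact i.elim0
  | succ N ih =>
    rw [List.ofFn_succ, List.prod_cons]
    refine Fin.cases ?_ (fun j => ?_) i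
    · have : (List.ofFn fun k : Fin N => f k.succ ^ (Pi.single 0 1 : Occ (N + 1)) k.succ) =
          List.replicate N 1 := by
        rw [← List.ofFn_const]
        congr 1
        funext k
        simp
      rw [this]
      simp
    · have := ih (fun k => f k.succ) j
      have h : ∀ k : Fin N, (Pi.single j.succ 1 : Occ (N + 1)) k.succ = (Pi.single j 1 : Occ N) k := by
        intro k
        simp [Pi.single_apply]
      simp only [h, this]
      simp [(Fin.succ_ne_zero _).symm]

theorem monomial_single_single {N : ℕ} (i j : Fin N) :
    monomial (Pi.single i 1) (Pi.single j 1) = create i * annihilate j := by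
  rw [monomial, list_prod_ofFn_pow_single, list_prod_ofFn_pow_single]

theorem toEnd_quadratic {N : ℕ} (α : Matrix (Fin N) (Fin N) ℂ) :
    (quadratic α).toEnd = ∑ i, ∑ j, α i j • (create i * annihilate j) := by
  have h : (quadratic α).toEnd = Finsupp.linearCombination ℂ
    (fun ef : Occ N × Occ N => monomial ef.1 ef.2) (quadratic α) := rfl
  rw [h, quadratic]
  simp only [map_sum, Finsupp.linearCombination_single, monomial_single_single]

/-- The second quantization of `α` as a differential operator in the Bargmann representation. -/
noncomputable def polyQuadratic {N : ℕ} (α : Matrix (Fin N) (Fin N) ℂ)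
    (p : MvPolynomial (Fin N) ℂ) : MvPolynomial (Fin N) ℂ :=
  ∑ i, ∑ j, α i j • (MvPolynomial.pderiv j p * MvPolynomial.X i)

theorem toEnd_quadratic_bargmann {N : ℕ} (α : Matrix (Fin N) (Fin N) ℂ)
    (p : MvPolynomial (Fin N) ℂ) :
    (quadratic α).toEnd (bargmann N p) = bargmann N (polyQuadratic α p) := by
  rw [toEnd_quadratic, polyQuadratic]
  simp only [LinearMap.sum_apply, LinearMap.smul_apply, Module.End.mul_apply,
    annihilate_bargmann, create_bargmann, map_sum, map_smul]

theorem polyQuadratic_add {N : ℕ} (α : Matrix (Fin N) (Fin N) ℂ) (p q : MvPolynomial (Fin N) ℂ) :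
    polyQuadratic α (p + q) = polyQuadratic α p + polyQuadratic α q := by
  simp only [polyQuadratic, map_add, add_mul, smul_add, Finset.sum_add_distrib]

theorem polyQuadratic_mul_X {N : ℕ} (α : Matrix (Fin N) (Fin N) ℂ) (p : MvPolynomial (Fin N) ℂ)
    (j : Fin N) :
    polyQuadratic α (p * MvPolynomial.X j) =
      ∑ i, α i j • (p * MvPolynomial.X i) + polyQuadratic α p * MvPolynomial.X j := by
  simp only [polyQuadratic, Derivation.leibniz, MvPolynomial.pderiv_X, add_mul, smul_add,
    Finset.sum_add_distrib, Finset.sum_mul]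
  congr 1
  · refine Finset.sum_congr rfl fun i _ => ?_
    rw [Finset.sum_eq_single j]
    · simp
    · intro k _ hk
      simp [Ne.symm hk]
    · simp
  · refine Finset.sum_congr rfl fun i _ => Finset.sum_congr rfl fun k _ => ?_
    rw [smul_mul_assoc, smul_eq_mul, mul_comm (MvPolynomial.X j), mul_right_comm,
      smul_mul_assoc, mul_right_comm]

/-- `u` is a one-parameter group of unitary matrices with generator `-i α`. -/
structure IsModeEvolution {N : ℕ} (α : Matrix (Fin N) (Fin N) ℂ)
    (u : ℝ → Matrix.unitaryGroup (Fin N) ℂ) : Prop where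
  zero : u 0 = 1
  add : ∀ s t, u (s + t) = u s * u t
  deriv : ∀ i j, HasDerivAt (fun t => (u t).1 i j) (-Complex.I * α i j) 0

theorem hasDerivAt_coeff_mul_X {N : ℕ} {q : ℝ → MvPolynomial (Fin N) ℂ}
    {q' : MvPolynomial (Fin N) ℂ} {x : ℝ}
    (h : ∀ s, HasDerivAt (fun t => (q t).coeff s) (q'.coeff s) x) (i : Fin N) (s : Fin N →₀ ℕ) :
    HasDerivAt (fun t => (q t * MvPolynomial.X i).coeff s) ((q' * MvPolynomial.X i).coeff s) x := by
  simp only [MvPolynomial.coeff_mul_X']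
  split_ifs
  · exact h _
  · exact hasDerivAt_const _ _

/-- Leibniz rule, one variable at a time: `polyQuadratic α` acts as a derivation, and at `t = 0` the
substitution is the identity. -/
theorem IsModeEvolution.hasDerivAt_coeff {N : ℕ} {α : Matrix (Fin N) (Fin N) ℂ}
    {u : ℝ → Matrix.unitaryGroup (Fin N) ℂ} (hu : IsModeEvolution α u)
    (p : MvPolynomial (Fin N) ℂ) (s : Fin N →₀ ℕ) :
    HasDerivAt (fun t => (linearSubst (u t).1 p).coeff s)
      ((-Complex.I • polyQuadratic α p).coeff s) 0 := by
  induction p using MvPolynomial.induction_on generalizing s with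
  | C a =>
    have h : ∀ t, linearSubst (u t).1 (MvPolynomial.C a) = MvPolynomial.C a := fun t => by
      simp [linearSubst]
    simp only [h, polyQuadratic, MvPolynomial.pderiv_C]
    simpa using hasDerivAt_const (0 : ℝ) ((MvPolynomial.C a).coeff s)
  | add p q hp hq =>
    simp only [map_add, polyQuadratic_add, smul_add, MvPolynomial.coeff_add]
    exact (hp s).add (hq s)
  | mul_X p j hp =>
    have h : ∀ t, (linearSubst (u t).1 (p * MvPolynomial.X j)).coeff s =
        ∑ i, (u t).1 i j * (linearSubst (u t).1 p * MvPolynomial.X i).coeff s := by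
      intro t
      rw [map_mul, linearSubst_X, Finset.mul_sum, MvPolynomial.coeff_sum]
      refine Finset.sum_congr rfl fun i _ => ?_
      rw [mul_smul_comm, MvPolynomial.coeff_smul, smul_eq_mul]
    simp only [h]
    have hd := HasDerivAt.fun_sum (u := Finset.univ) fun i _ =>
      (hu.deriv i j).mul (hasDerivAt_coeff_mul_X hp i s)
    refine hd.congr_deriv ?_
    symm
    rw [hu.zero, Matrix.UnitaryGroup.one_val, linearSubst_one, polyQuadratic_mul_X, smul_add,
      MvPolynomial.coeff_add, Finset.sum_add_distrib]
    congr 1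
    · rw [Finset.smul_sum, MvPolynomial.coeff_sum]
      refine Finset.sum_congr rfl fun i _ => ?_
      simp [mul_assoc]
    · rw [Finset.sum_eq_single j]
      · simp
      · intro i _ hi
        simp [hi]
      · simp

-- A support bound independent of `u` keeps the orbit of a polynomial in a finite-dimensional space,
-- so a derivative in Fock norm reduces to finitely many coefficients.
open scoped Pointwise in
theorem exists_support_linearSubst_subset {N : ℕ} (p : MvPolynomial (Fin N) ℂ) :
    ∃ F : Finset (Fin N →₀ ℕ), ∀ u, (linearSubst u p).support ⊆ F := by
  induction p using MvPolynomial.induction_on with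
  | C a =>
    refine ⟨(MvPolynomial.C a).support, fun u => ?_⟩
    simp [linearSubst]
  | add p q hp hq =>
    obtain ⟨F, hF⟩ := hp
    obtain ⟨F', hF'⟩ := hq
    refine ⟨F ∪ F', fun u => ?_⟩
    rw [map_add]
    exact MvPolynomial.support_add.trans (Finset.union_subset_union (hF u) (hF' u))
  | mul_X p j hp =>
    obtain ⟨F, hF⟩ := hp
    refine ⟨F + Finset.univ.biUnion fun i =>
      (MvPolynomial.X i : MvPolynomial (Fin N) ℂ).support, fun u => ?_⟩
    rw [map_mul, linearSubst_X]
    refine (MvPolynomial.support_mul _ _).trans (Finset.add_subset_add (hF u) ?_)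
    refine MvPolynomial.support_sum.trans (Finset.biUnion_mono fun i _ => ?_)
    exact MvPolynomial.support_smul

theorem bargmann_eq_sum {N : ℕ} {q : MvPolynomial (Fin N) ℂ} {F : Finset (Fin N →₀ ℕ)}
    (h : q.support ⊆ F) :
    incl N (bargmann N q) =
      ∑ s ∈ F, q.coeff s • incl N (bargmann N (MvPolynomial.monomial s 1)) := by
  conv_lhs => rw [q.as_sum]
  rw [Finset.sum_subset h fun s _ hs => by
    rw [MvPolynomial.notMem_support_iff.1 hs, MvPolynomial.monomial_zero], map_sum, map_sum]
  refine Finset.sum_congr rfl fun s _ => ?_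
  rw [← map_smul, ← map_smul, MvPolynomial.smul_monomial, smul_eq_mul, mul_one]

theorem IsModeEvolution.hasDerivAt_incl {N : ℕ} {α : Matrix (Fin N) (Fin N) ℂ}
    {u : ℝ → Matrix.unitaryGroup (Fin N) ℂ} (hu : IsModeEvolution α u) (v : Core N) :
    HasDerivAt (fun t => incl N (coreAction (u t) v))
      (-Complex.I • incl N ((quadratic α).toEnd v)) 0 := by
  obtain ⟨p, rfl⟩ := (bargmann N).surjective v
  obtain ⟨F, hF⟩ := exists_support_linearSubst_subset p
  rw [toEnd_quadratic_bargmann, ← map_smul, ← map_smul,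
    bargmann_eq_sum (F := F ∪ (-Complex.I • polyQuadratic α p).support) Finset.subset_union_right]
  have h : ∀ t, incl N (coreAction (u t) (bargmann N p)) =
      ∑ s ∈ F ∪ (-Complex.I • polyQuadratic α p).support,
        (linearSubst (u t).1 p).coeff s • incl N (bargmann N (MvPolynomial.monomial s 1)) := by
    intro t
    rw [coreAction_bargmann, bargmann_eq_sum ((hF (u t).1).trans Finset.subset_union_left)]
  simp only [h]
  exact HasDerivAt.fun_sum fun s _ => (hu.hasDerivAt_coeff p s).smul_const _

theorem IsModeEvolution.isEvolution {N : ℕ} {α : Matrix (Fin N) (Fin N) ℂ}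
    {u : ℝ → Matrix.unitaryGroup (Fin N) ℂ} (hu : IsModeEvolution α u) :
    IsEvolution (quadratic α).toEnd fun t => secondQuant (u t) where
  zero := by rw [hu.zero, secondQuant_one]
  add s t := by rw [hu.add, secondQuant_mul]
  deriv v := by
    simp only [secondQuant_incl]
    exact hu.hasDerivAt_incl v
  continuous ψ := by
    have hcore : ∀ v, Continuous fun t => secondQuant (u t) (incl N v) := by
      intro v
      refine continuous_iff_continuousAt.2 fun t => ?_
      have h0 : ContinuousAt (fun s => secondQuant (u s) (incl N v)) (t - t) := by
        simp only [secondQuant_incl, sub_self]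
        exact (hu.hasDerivAt_incl v).continuousAt
      -- The group law transports continuity from `0` to `t`.
      have h1 : ContinuousAt (fun s => secondQuant (u (s - t)) (incl N v)) t :=
        ContinuousAt.comp (f := fun s => s - t) h0 (by fun_prop)
      have h2 := (secondQuant (u t)).continuous.continuousAt.comp h1
      refine h2.congr (Filter.Eventually.of_forall fun s => ?_)
      change (secondQuant (u t) * secondQuant (u (s - t))) (incl N v) = _
      rw [← secondQuant_mul, ← hu.add, add_sub_cancel]
    -- Isometries make approximation by core vectors uniform in `t`.
    refine continuous_of_uniform_approx_of_continuous fun V hV => ?_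
    obtain ⟨ε, hε, hV⟩ := Metric.mem_uniformity_dist.1 hV
    obtain ⟨v, hv⟩ := (denseRange_incl N).exists_dist_lt ψ hε
    refine ⟨_, hcore v, fun t => hV ?_⟩
    rwa [LinearIsometryEquiv.dist_map]

/-! ### Uniqueness of the evolution: essential self-adjointness -/

/-- A product rule although `U` is only known to be differentiable on core vectors. With `w =
φ'(0)`, the increment is `U(-t)(φ(t) - φ(0) - tw) + t(U(-t)w - w) + (U(-t)φ(0) - φ(0) + tw)`. The
terms are `o(t)` by isometry, strong continuity and the generator condition respectively. -/
theorem IsEvolution.hasDerivAt_neg_comp {N : ℕ} {A : Module.End ℂ (Core N)}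
    {U : ℝ → Fock N ≃ₗᵢ[ℂ] Fock N} (hU : IsEvolution A U) {φ : ℝ → Fock N} {v : Core N}
    (h0 : φ 0 = incl N v) (hφ : HasDerivAt φ (-Complex.I • incl N (A v)) 0) :
    HasDerivAt (fun t => U (-t) (φ t)) 0 0 := by
  have hneg : HasDerivAt (fun t => U (-t) (φ 0)) (Complex.I • incl N (A v)) 0 := by
    have h1 := hU.deriv v
    rw [← neg_zero] at h1
    have := h1.scomp (0 : ℝ) (hasDerivAt_neg (0 : ℝ))
    rw [h0]
    simpa [Function.comp_def] using this
  set w := -Complex.I • incl N (A v) with hw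
  rw [hasDerivAt_iff_isLittleO] at hφ hneg ⊢
  have hcont : (fun t : ℝ => t • (U (-t) w - w)) =o[nhds 0] fun t => t - 0 := by
    have h1 : (fun t : ℝ => U (-t) w - w) =o[nhds 0] fun _ => (1 : ℝ) := by
      rw [Asymptotics.isLittleO_one_iff]
      have := ((hU.continuous w).comp continuous_neg).tendsto 0
      simp only [Function.comp_def, neg_zero, hU.zero] at this
      simpa using this.sub_const w
    simpa using (Asymptotics.isBigO_refl (fun t : ℝ => t) (nhds 0)).smul_isLittleO h1
  have hiso : (fun t : ℝ => U (-t) (φ t - φ 0 - (t - 0) • w)) =o[nhds 0] fun t => t - 0 :=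
    Asymptotics.IsLittleO.of_norm_left (by
      simpa only [LinearIsometryEquiv.norm_map] using hφ.norm_left)
  refine ((hiso.add hcont).add hneg).congr_left fun t => ?_
  have hr : ∀ x : Fock N, U (-t) (t • x) = t • U (-t) x := fun x =>
    LinearMapClass.map_smul_of_tower (U (-t)) t x
  have hwI : Complex.I • incl N (A v) = -w := by rw [hw, neg_smul, neg_neg]
  simp only [map_sub, sub_zero, smul_zero, neg_zero, hr, hwI, smul_sub, hU.zero, smul_neg]
  simp only [LinearIsometryEquiv.coe_one, id_eq]
  abel

/-- Second quantized mode changes preserve the core. Hence the derivative of `U(-t) Γ(u_t) v` at any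
`x` reduces to the one at `0` for the core vector `Γ(u_x) v`; it vanishes, so the path is constant.
-/
theorem IsModeEvolution.eq_secondQuant {N : ℕ} {α : Matrix (Fin N) (Fin N) ℂ}
    {u : ℝ → Matrix.unitaryGroup (Fin N) ℂ} (hu : IsModeEvolution α u)
    {U : ℝ → Fock N ≃ₗᵢ[ℂ] Fock N} (hU : IsEvolution (quadratic α).toEnd U) :
    U = fun t => secondQuant (u t) := by
  funext t
  refine isometryEquiv_ext fun v => ?_
  have hderiv : ∀ x : ℝ, HasDerivAt (fun t => U (-t) (secondQuant (u t) (incl N v))) 0 x := by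
    intro x
    have h0 : HasDerivAt (fun t => U (-t) (incl N (coreAction (u t) (coreAction (u x) v)))) 0 0 :=
      hU.hasDerivAt_neg_comp (by rw [hu.zero, coreAction_one]) (hu.hasDerivAt_incl _)
    rw [← sub_self x] at h0
    have h1 := HasDerivAt.scomp (h := fun t => t - x) x h0 ((hasDerivAt_id x).sub_const x)
    have h2 := (U (-x)).toContinuousLinearEquiv.toContinuousLinearMap.restrictScalars ℝ
      |>.hasFDerivAt.comp_hasDerivAt x h1
    refine (h2.congr_deriv (by simp)).congr_of_eventuallyEq (Filter.Eventually.of_forall fun t => ?_)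
    change _ = (U (-x) * U (-(t - x))) _
    rw [← hU.add, ← coreAction_mul, ← hu.add, ← secondQuant_incl]
    ring_nf
  have hconst := is_const_of_deriv_eq_zero (fun x => (hderiv x).differentiableAt)
    (fun x => (hderiv x).deriv) t 0
  simp only [neg_zero, hU.zero, hu.zero, secondQuant_one, LinearIsometryEquiv.coe_one,
    id_eq] at hconst
  have h : U t (U (-t) (secondQuant (u t) (incl N v))) = secondQuant (u t) (incl N v) := by
    change (U t * U (-t)) _ = _
    rw [← hU.add, add_neg_cancel, hU.zero]
    rfl
  rw [← h, hconst]

theorem IsModeEvolution.isEssSelfAdjoint {N : ℕ} {α : Matrix (Fin N) (Fin N) ℂ}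
    {u : ℝ → Matrix.unitaryGroup (Fin N) ℂ} (hu : IsModeEvolution α u) :
    IsEssSelfAdjoint (quadratic α).toEnd :=
  ⟨_, hu.isEvolution, fun _ hU => hu.eq_secondQuant hU⟩

theorem IsModeEvolution.evolution_eq {N : ℕ} {α : Matrix (Fin N) (Fin N) ℂ}
    {u : ℝ → Matrix.unitaryGroup (Fin N) ℂ} (hu : IsModeEvolution α u) (t : ℝ) :
    evolution (quadratic α).toEnd t = secondQuant (u t) := by
  rw [evolution, dif_pos hu.isEssSelfAdjoint]
  exact congrFun (hu.eq_secondQuant hu.isEssSelfAdjoint.choose_spec.1) t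

/-! ### Structural bounds on quadratic operators; membership in the Hamiltonian class -/

theorem quadratic_apply {N : ℕ} (α : Matrix (Fin N) (Fin N) ℂ) (ef : Occ N × Occ N) :
    quadratic α ef =
      ∑ i, ∑ j, if ((Pi.single i 1, Pi.single j 1) : Occ N × Occ N) = ef then α i j else 0 := by
  simp only [quadratic, Finsupp.finsetSum_apply, Finsupp.single_apply]

theorem single_pair_inj {N : ℕ} {i j k l : Fin N}
    (h : ((Pi.single i 1, Pi.single j 1) : Occ N × Occ N) = (Pi.single k 1, Pi.single l 1)) :
    i = k ∧ j = l := by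
  have hinj : ∀ {a b : Fin N}, (Pi.single a 1 : Occ N) = Pi.single b 1 → a = b := by
    intro a b hab
    by_contra hne
    have := congrFun hab a
    simp [hne] at this
  exact ⟨hinj (congrArg Prod.fst h), hinj (congrArg Prod.snd h)⟩

theorem quadratic_apply_single {N : ℕ} (α : Matrix (Fin N) (Fin N) ℂ) (i j : Fin N) :
    quadratic α (Pi.single i 1, Pi.single j 1) = α i j := by
  rw [quadratic_apply, Finset.sum_eq_single i, Finset.sum_eq_single j, if_pos rfl]
  · exact fun l _ hl => if_neg fun h => hl (single_pair_inj h).2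
  · simp
  · exact fun k _ hk => Finset.sum_eq_zero fun l _ => if_neg fun h => hk (single_pair_inj h).1
  · simp

theorem exists_of_quadratic_apply_ne_zero {N : ℕ} {α : Matrix (Fin N) (Fin N) ℂ}
    {ef : Occ N × Occ N} (h : quadratic α ef ≠ 0) :
    ∃ i j, ef = (Pi.single i 1, Pi.single j 1) ∧ α i j ≠ 0 := by
  rw [quadratic_apply] at h
  obtain ⟨i, _, hi⟩ := Finset.exists_ne_zero_of_sum_ne_zero h
  obtain ⟨j, _, hj⟩ := Finset.exists_ne_zero_of_sum_ne_zero hi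
  rw [ite_ne_right_iff] at hj
  exact ⟨i, j, hj.1.symm, hj.2⟩

theorem quadratic_hermitian {N : ℕ} {α : Matrix (Fin N) (Fin N) ℂ}
    (h : ∀ i j, α j i = (starRingEnd ℂ) (α i j)) : (quadratic α).Hermitian := by
  intro e f
  rw [quadratic_apply, quadratic_apply, Finset.sum_comm, map_sum]
  refine Finset.sum_congr rfl fun i _ => ?_
  rw [map_sum]
  refine Finset.sum_congr rfl fun j _ => ?_
  simp only [Prod.mk.injEq]
  rw [h i j, apply_ite (starRingEnd ℂ), map_zero]
  exact if_congr and_comm rfl rfl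

theorem quadratic_normalized {N : ℕ} {α : Matrix (Fin N) (Fin N) ℂ} (h : ∀ i j, ‖α i j‖ ≤ 1) :
    (quadratic α).Normalized := by
  intro ef
  by_cases h0 : quadratic α ef = 0
  · simp [h0]
  · obtain ⟨i, j, rfl, -⟩ := exists_of_quadratic_apply_ne_zero h0
    rw [quadratic_apply_single]
    exact h i j

theorem sum_single_one {N : ℕ} (i : Fin N) : ∑ k, (Pi.single i 1 : Occ N) k = 1 := by
  simp [Finset.sum_pi_single']

theorem quadratic_numberConserving {N : ℕ} (α : Matrix (Fin N) (Fin N) ℂ) :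
    (quadratic α).NumberConserving := by
  intro ef hef
  obtain ⟨i, j, rfl, -⟩ := exists_of_quadratic_apply_ne_zero (Finsupp.mem_support_iff.1 hef)
  rw [sum_single_one, sum_single_one]

theorem quadratic_degreeLE {N d : ℕ} (hd : 2 ≤ d) (α : Matrix (Fin N) (Fin N) ℂ) :
    (quadratic α).DegreeLE d := by
  intro ef hef
  obtain ⟨i, j, rfl, -⟩ := exists_of_quadratic_apply_ne_zero (Finsupp.mem_support_iff.1 hef)
  rwa [sum_single_one, sum_single_one]

theorem quadratic_weightLE {N w : ℕ} (hw : 2 ≤ w) (α : Matrix (Fin N) (Fin N) ℂ) :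
    (quadratic α).WeightLE w := by
  intro ef hef
  obtain ⟨i, j, rfl, -⟩ := exists_of_quadratic_apply_ne_zero (Finsupp.mem_support_iff.1 hef)
  have h : ∀ i : Fin N, (Finset.univ.filter fun k => (Pi.single i 1 : Occ N) k ≠ 0).card = 1 := by
    intro i
    rw [Finset.card_eq_one]
    refine ⟨i, ?_⟩
    ext k
    simp [Pi.single_apply]
  simpa only [h] using hw

theorem quadratic_actsOn {N : ℕ} {α : Matrix (Fin N) (Fin N) ℂ} {I : Finset (Fin N)}
    (h : ∀ i j, α i j ≠ 0 → i ∈ I ∧ j ∈ I) : (quadratic α).ActsOn I := by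
  intro ef hef k hk
  obtain ⟨i, j, rfl, hij⟩ := exists_of_quadratic_apply_ne_zero (Finsupp.mem_support_iff.1 hef)
  obtain ⟨hi, hj⟩ := h i j hij
  exact ⟨Pi.single_eq_of_ne (ne_of_mem_of_not_mem hi hk).symm _,
    Pi.single_eq_of_ne (ne_of_mem_of_not_mem hj hk).symm _⟩

-- The group is `e^{-itα}`, unitary because `-iα` is skew-adjoint.
open scoped Matrix.Norms.Operator in
theorem exists_isModeEvolution {N : ℕ} {α : Matrix (Fin N) (Fin N) ℂ}
    (h : ∀ i j, α j i = (starRingEnd ℂ) (α i j)) : ∃ u, IsModeEvolution α u := by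
  set X : Matrix (Fin N) (Fin N) ℂ := -Complex.I • α with hX
  have hα : star α = α := by
    ext i j
    rw [Matrix.star_apply, RCLike.star_def, ← h]
  have hstar : star X = -X := by
    rw [hX, star_smul, hα]
    simp
  have hmul : ∀ s t : ℝ, NormedSpace.exp ((s + t) • X) =
      NormedSpace.exp (s • X) * NormedSpace.exp (t • X) := by
    intro s t
    rw [add_smul, Matrix.exp_add_of_commute]
    exact ((Commute.refl X).smul_left s).smul_right t
  have hmem : ∀ t : ℝ, NormedSpace.exp (t • X) ∈ Matrix.unitaryGroup (Fin N) ℂ := by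
    intro t
    rw [Matrix.mem_unitaryGroup_iff, Matrix.star_eq_conjTranspose, ← Matrix.exp_conjTranspose,
      ← Matrix.star_eq_conjTranspose, star_smul, hstar, smul_neg, star_trivial, ← neg_smul,
      ← hmul, add_neg_cancel, zero_smul, NormedSpace.exp_zero]
  refine ⟨fun t => ⟨_, hmem t⟩, ?_, ?_, ?_⟩
  · refine Subtype.ext ?_
    simp
  · exact fun s t => Subtype.ext (hmul s t)
  · intro i j
    have hd := hasDerivAt_exp_smul_const (𝕂 := ℝ) X 0
    have h2 := (LinearMap.toContinuousLinearMap
      (Matrix.entryLinearMap ℝ ℂ i j)).hasFDerivAt.comp_hasDerivAt 0 hd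
    refine h2.congr_deriv ?_
    rw [zero_smul, NormedSpace.exp_zero, one_mul]
    rfl

theorem quadratic_mem_hamiltonianClass {w d N : ℕ} (hw : 2 ≤ w) (hd : 2 ≤ d)
    {α : Matrix (Fin N) (Fin N) ℂ} (h : ∀ i j, α j i = (starRingEnd ℂ) (α i j))
    (hα : ∀ i j, ‖α i j‖ ≤ 1) : quadratic α ∈ hamiltonianClass w d N :=
  ⟨quadratic_hermitian h, quadratic_numberConserving α, quadratic_normalized hα,
    quadratic_weightLE hw α, quadratic_degreeLE hd α,
    (exists_isModeEvolution h).choose_spec.isEssSelfAdjoint⟩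

/-! ### Closed-form one-parameter groups for the elementary gates -/

/-- The matrix `e^{-iθβ}`, for `β` with `β ^ 3 = β`. -/
noncomputable def trigMatrix {N : ℕ} (β : Matrix (Fin N) (Fin N) ℂ) (θ : ℝ) :
    Matrix (Fin N) (Fin N) ℂ :=
  1 + (Complex.cos θ - 1) • (β * β) - (Complex.I * Complex.sin θ) • β

theorem trigMatrix_zero {N : ℕ} (β : Matrix (Fin N) (Fin N) ℂ) : trigMatrix β 0 = 1 := by
  simp [trigMatrix]

/-- Since `β³ = β`, products stay in the span of `1`, `β`, `β²`, and the coefficients match by the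
addition formulas. -/
theorem trigMatrix_add {N : ℕ} {β : Matrix (Fin N) (Fin N) ℂ} (hβ : β * β * β = β) (s t : ℝ) :
    trigMatrix β (s + t) = trigMatrix β s * trigMatrix β t := by
  have h3 : β * (β * β) = β := by rw [← mul_assoc, hβ]
  have h4 : β * β * (β * β) = β * β := by rw [← mul_assoc, hβ]
  have hI := Complex.I_mul_I
  simp only [trigMatrix, Complex.ofReal_add, Complex.cos_add, Complex.sin_add, sub_mul, mul_sub,
    add_mul, mul_add, one_mul, mul_one, smul_mul_assoc, mul_smul_comm, h3, h4,
    hβ]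
  match_scalars
  · ring
  · linear_combination (-Complex.sin s * Complex.sin t) * hI
  · ring

theorem star_trigMatrix {N : ℕ} {β : Matrix (Fin N) (Fin N) ℂ} (hβ : star β = β) (θ : ℝ) :
    star (trigMatrix β θ) = trigMatrix β (-θ) := by
  simp only [trigMatrix, star_sub, star_add, star_one, star_smul, star_mul, hβ, RCLike.star_def,
    Complex.conj_I, ← Complex.cos_conj, ← Complex.sin_conj,
    Complex.conj_ofReal, Complex.ofReal_neg, Complex.cos_neg, Complex.sin_neg, mul_neg]
  rw [mul_comm (Complex.sin _)]

/-- The one-parameter group of unitary matrices generated by a Hermitian `β` with `β ^ 3 = β`. -/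
noncomputable def trigUnitary {N : ℕ} (β : Matrix (Fin N) (Fin N) ℂ) (hβ : star β = β)
    (hβ3 : β * β * β = β) (θ : ℝ) : Matrix.unitaryGroup (Fin N) ℂ :=
  ⟨trigMatrix β θ, Matrix.mem_unitaryGroup_iff.2 (by
    rw [star_trigMatrix hβ, ← trigMatrix_add hβ3, add_neg_cancel, trigMatrix_zero])⟩

theorem isModeEvolution_trigUnitary {N : ℕ} (β : Matrix (Fin N) (Fin N) ℂ) (hβ : star β = β)
    (hβ3 : β * β * β = β) : IsModeEvolution β (trigUnitary β hβ hβ3) where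
  zero := Subtype.ext (trigMatrix_zero β)
  add s t := Subtype.ext (trigMatrix_add hβ3 s t)
  deriv i j := by
    have hc : HasDerivAt (fun t : ℝ => Complex.cos t) 0 0 := by
      simpa using (Complex.hasDerivAt_cos (0 : ℝ)).comp_ofReal
    have hs : HasDerivAt (fun t : ℝ => Complex.sin t) 1 0 := by
      simpa using (Complex.hasDerivAt_sin (0 : ℝ)).comp_ofReal
    have := (((hc.sub_const 1).mul_const ((β * β) i j)).const_add
      ((1 : Matrix (Fin N) (Fin N) ℂ) i j)).sub ((hs.const_mul Complex.I).mul_const (β i j))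
    refine (this.congr_deriv (by ring)).congr_of_eventuallyEq
      (Filter.Eventually.of_forall fun t => ?_)
    simp [trigUnitary, trigMatrix]

/-! ### Givens decomposition into elementary gates -/

open Matrix in
/-- `u` acts as the identity outside of the modes in `S`. -/
def SupportedOn {N : ℕ} (S : Finset (Fin N)) (u : unitaryGroup (Fin N) ℂ) : Prop :=
  (∀ v, ∀ j ∉ S, (u.1 *ᵥ v) j = v j) ∧ ∀ v, (∀ j ∈ S, v j = 0) → u.1 *ᵥ v = v

open Matrix in
theorem SupportedOn.mul {N : ℕ} {S : Finset (Fin N)} {u v : unitaryGroup (Fin N) ℂ}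
    (hu : SupportedOn S u) (hv : SupportedOn S v) : SupportedOn S (u * v) := by
  refine ⟨fun x j hj => ?_, fun x hx => ?_⟩
  · rw [UnitaryGroup.mul_val, ← mulVec_mulVec, hu.1 _ j hj, hv.1 _ j hj]
  · rw [UnitaryGroup.mul_val, ← mulVec_mulVec, hv.2 x hx, hu.2 x hx]

theorem SupportedOn.mono {N : ℕ} {S S' : Finset (Fin N)} {u : Matrix.unitaryGroup (Fin N) ℂ}
    (hu : SupportedOn S u) (h : S ⊆ S') : SupportedOn S' u :=
  ⟨fun v j hj => hu.1 v j fun hS => hj (h hS), fun v hv => hu.2 v fun j hj => hv j (h hj)⟩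

theorem supportedOn_one {N : ℕ} (S : Finset (Fin N)) :
    SupportedOn S (1 : Matrix.unitaryGroup (Fin N) ℂ) := by
  simp [SupportedOn]

/-- `u` is implemented by a circuit of at most `k` elementary gates. -/
def Implementable (w d : ℕ) {N : ℕ} (k : ℕ) (u : Matrix.unitaryGroup (Fin N) ℂ) : Prop :=
  ∃ L : List (Gate w d N), L.length ≤ k ∧ (L.map Gate.unitary).prod = secondQuant u

theorem implementable_one (w d : ℕ) {N : ℕ} :
    Implementable w d 0 (1 : Matrix.unitaryGroup (Fin N) ℂ) :=
  ⟨[], le_rfl, by rw [secondQuant_one]; rfl⟩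

theorem Implementable.mul {w d N k l : ℕ} {u v : Matrix.unitaryGroup (Fin N) ℂ}
    (hu : Implementable w d k u) (hv : Implementable w d l v) :
    Implementable w d (k + l) (u * v) := by
  obtain ⟨L, hL, hLu⟩ := hu
  obtain ⟨L', hL', hLv⟩ := hv
  refine ⟨L ++ L', ?_, ?_⟩
  · rw [List.length_append]
    exact add_le_add hL hL'
  · rw [List.map_append, List.prod_append, hLu, hLv, secondQuant_mul]

theorem Implementable.mono {w d N k l : ℕ} {u : Matrix.unitaryGroup (Fin N) ℂ}
    (hu : Implementable w d k u) (h : k ≤ l) : Implementable w d l u := by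
  obtain ⟨L, hL, hLu⟩ := hu
  exact ⟨L, hL.trans h, hLu⟩

/-- A Hermitian matrix that generates an elementary gate and satisfies `β ^ 3 = β`. -/
structure IsGateGenerator {N : ℕ} (S : Finset (Fin N)) (β : Matrix (Fin N) (Fin N) ℂ) : Prop where
  star_eq : star β = β
  cube_eq : β * β * β = β
  norm_le : ∀ i j, ‖β i j‖ ≤ 1
  card_le : S.card ≤ 2
  mem : ∀ i j, β i j ≠ 0 → i ∈ S ∧ j ∈ S

/-- The unitary matrix `e^{-iθβ}` of the modes. -/
noncomputable def IsGateGenerator.unitary {N : ℕ} {S : Finset (Fin N)}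
    {β : Matrix (Fin N) (Fin N) ℂ} (h : IsGateGenerator S β) (θ : ℝ) :
    Matrix.unitaryGroup (Fin N) ℂ := trigUnitary β h.star_eq h.cube_eq θ

theorem IsGateGenerator.isModeEvolution {N : ℕ} {S : Finset (Fin N)}
    {β : Matrix (Fin N) (Fin N) ℂ} (h : IsGateGenerator S β) : IsModeEvolution β h.unitary :=
  isModeEvolution_trigUnitary β h.star_eq h.cube_eq

/-- Gate angles are at most `1`, whereas the angles needed are arguments of complex numbers, at most
`π ≤ 4`. Four copies at a quarter of the angle suffice. -/
theorem IsGateGenerator.implementable {N : ℕ} {S : Finset (Fin N)}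
    {β : Matrix (Fin N) (Fin N) ℂ} (h : IsGateGenerator S β) {w d : ℕ} (hw : 2 ≤ w) (hd : 2 ≤ d)
    {θ : ℝ} (hθ : |θ| ≤ 4) : Implementable w d 4 (h.unitary θ) := by
  let g : Gate w d N :=
    { O := quadratic β
      θ := θ / 4
      abs_le := by
        rw [abs_div, abs_of_pos (by norm_num : (0 : ℝ) < 4)]
        linarith
      hermitian := quadratic_hermitian fun i j => by
        rw [← RCLike.star_def, ← Matrix.star_apply, h.star_eq]
      normalized := quadratic_normalized h.norm_le
      weight_le := quadratic_weightLE hw β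
      degree_le := quadratic_degreeLE hd β
      acts_on := ⟨S, h.card_le.trans hw, quadratic_actsOn h.mem⟩
      ess_self_adjoint := h.isModeEvolution.isEssSelfAdjoint }
  refine ⟨List.replicate 4 g, by simp, ?_⟩
  have hg : g.unitary = secondQuant (h.unitary (θ / 4)) := h.isModeEvolution.evolution_eq (θ / 4)
  have hθ4 : θ = θ / 4 + (θ / 4 + (θ / 4 + θ / 4)) := by ring
  conv_rhs => rw [hθ4]
  simp only [h.isModeEvolution.add, secondQuant_mul, ← hg]
  simp [List.replicate]

theorem IsGateGenerator.implementable_inv {N : ℕ} {S : Finset (Fin N)}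
    {β : Matrix (Fin N) (Fin N) ℂ} (h : IsGateGenerator S β) {w d : ℕ} (hw : 2 ≤ w) (hd : 2 ≤ d)
    {θ : ℝ} (hθ : |θ| ≤ 4) : Implementable w d 4 (h.unitary θ)⁻¹ := by
  have : (h.unitary θ)⁻¹ = h.unitary (-θ) := by
    rw [inv_eq_iff_mul_eq_one, ← h.isModeEvolution.add, add_neg_cancel, h.isModeEvolution.zero]
  rw [this]
  exact h.implementable hw hd (by rwa [abs_neg])

open Matrix in
theorem IsGateGenerator.mulVec_unitary {N : ℕ} {S : Finset (Fin N)}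
    {β : Matrix (Fin N) (Fin N) ℂ} (h : IsGateGenerator S β) (θ : ℝ) (v : Fin N → ℂ) :
    (h.unitary θ).1 *ᵥ v =
      v + (Complex.cos θ - 1) • (β *ᵥ (β *ᵥ v)) - (Complex.I * Complex.sin θ) • (β *ᵥ v) := by
  simp only [unitary, trigUnitary, trigMatrix, sub_mulVec, add_mulVec, one_mulVec, smul_mulVec,
    mulVec_mulVec]

open Matrix in
theorem IsGateGenerator.supportedOn {N : ℕ} {S : Finset (Fin N)}
    {β : Matrix (Fin N) (Fin N) ℂ} (h : IsGateGenerator S β) (θ : ℝ) :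
    SupportedOn S (h.unitary θ) := by
  have h1 : ∀ v, ∀ j ∉ S, (β *ᵥ v) j = 0 := by
    intro v j hj
    rw [mulVec, dotProduct]
    refine Finset.sum_eq_zero fun k _ => ?_
    rw [show β j k = 0 from by_contra fun h0 => hj (h.mem j k h0).1, zero_mul]
  have h2 : ∀ v, (∀ j ∈ S, v j = 0) → β *ᵥ v = 0 := by
    intro v hv
    funext j
    rw [mulVec, dotProduct]
    refine Finset.sum_eq_zero fun k _ => ?_
    by_cases h0 : β j k = 0
    · rw [h0, zero_mul]
    · rw [hv k (h.mem j k h0).2, mul_zero]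
  refine ⟨fun v j hj => ?_, fun v hv => ?_⟩
  · rw [h.mulVec_unitary]
    simp only [Pi.sub_apply, Pi.add_apply, Pi.smul_apply, h1 _ j hj, smul_zero, add_zero, sub_zero]
  · rw [h.mulVec_unitary, h2 v hv]
    simp

theorem isGateGenerator_phase {N : ℕ} (i : Fin N) :
    IsGateGenerator {i} (Matrix.single i i (1 : ℂ)) where
  star_eq := by simp [Matrix.star_eq_conjTranspose]
  cube_eq := by simp
  norm_le j k := by
    rw [Matrix.single_apply]
    split_ifs <;> simp
  card_le := by simp
  mem j k := by
    rw [Matrix.single_apply, ite_ne_right_iff]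
    rintro ⟨⟨rfl, rfl⟩, -⟩
    simp

/-- The square is the projection onto the coordinate plane of `i` and `k`, hence the cube identity;
the factor `I` makes the generated group a real rotation of that plane. -/
theorem isGateGenerator_beamSplitter {N : ℕ} {i k : Fin N} (hik : i ≠ k) :
    IsGateGenerator {i, k} (Matrix.single i k Complex.I - Matrix.single k i Complex.I) where
  star_eq := by
    simp [Matrix.star_eq_conjTranspose, ← Matrix.single_neg]
    abel
  cube_eq := by
    simp [sub_mul, mul_sub, add_mul, hik, hik.symm, ← Matrix.single_neg]
  norm_le j l := by
    rw [Matrix.sub_apply, Matrix.single_apply, Matrix.single_apply]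
    split_ifs with h1 h2
    · exact absurd (h1.1.trans h2.1.symm) hik
    all_goals simp
  card_le := Finset.card_le_two
  mem j l := by
    rw [Matrix.sub_apply, Matrix.single_apply, Matrix.single_apply]
    split_ifs with h1 h2 h2
    · simp
    · simp [← h1.1, ← h1.2]
    · simp [← h2.1, ← h2.2]
    · simp

open Matrix in
theorem phase_mulVec {N : ℕ} (i : Fin N) (θ : ℝ) (v : Fin N → ℂ) :
    (((isGateGenerator_phase i).unitary θ).1 *ᵥ v) i = Complex.exp (-θ * Complex.I) * v i := by
  rw [IsGateGenerator.mulVec_unitary, Complex.exp_mul_I]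
  simp [single_mulVec]
  ring

open Matrix in
theorem phase_arg_mulVec {N : ℕ} (i : Fin N) (v : Fin N → ℂ) :
    (((isGateGenerator_phase i).unitary (v i).arg).1 *ᵥ v) i = ‖v i‖ := by
  rw [phase_mulVec]
  conv_lhs => rw [← Complex.norm_mul_exp_arg_mul_I (v i)]
  rw [mul_left_comm, ← Complex.exp_add, Complex.norm_mul_exp_arg_mul_I]
  simp

open Matrix in
theorem beamSplitter_mulVec {N : ℕ} {i k : Fin N} (hik : i ≠ k) (θ : ℝ) (v : Fin N → ℂ) :
    (((isGateGenerator_beamSplitter hik).unitary θ).1 *ᵥ v) i =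
      Complex.cos θ * v i + Complex.sin θ * v k := by
  have hI := Complex.I_mul_I
  rw [IsGateGenerator.mulVec_unitary]
  simp [single_mulVec, sub_mulVec, hik, hik.symm]
  linear_combination (-(Complex.cos θ - 1) * v i - Complex.sin θ * v k) * hI

theorem abs_arg_le_four (z : ℂ) : |z.arg| ≤ 4 := (Complex.abs_arg_le_pi z).trans Real.pi_le_four

open Matrix in
/-- A Givens rotation in the modes `i` and `k`. -/
theorem exists_implementable_clear_entry {w d N : ℕ} (hw : 2 ≤ w) (hd : 2 ≤ d) {i k : Fin N}
    (hik : i ≠ k) (v : Fin N → ℂ) :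
    ∃ g : unitaryGroup (Fin N) ℂ,
      Implementable w d 12 g⁻¹ ∧ SupportedOn {i, k} g ∧ (g.1 *ᵥ v) i = 0 := by
  set p := (isGateGenerator_phase i).unitary (v i).arg with hp
  set q := (isGateGenerator_phase k).unitary (v k).arg with hq
  -- Once phases have made both entries nonnegative, rotation by `-arg z` turns entry `i` into
  -- `cos(arg z)‖v i‖ - sin(arg z)‖v k‖ = 0`. Three factors of four gates give the `12`.
  let z : ℂ := ⟨‖v k‖, ‖v i‖⟩
  set r := (isGateGenerator_beamSplitter hik).unitary (-z.arg) with hr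
  have hps : SupportedOn {i} p := IsGateGenerator.supportedOn _ _
  have hqs : SupportedOn {k} q := IsGateGenerator.supportedOn _ _
  refine ⟨r * (p * q), ?_, ?_, ?_⟩
  · rw [_root_.mul_inv_rev, _root_.mul_inv_rev]
    exact (((isGateGenerator_phase k).implementable_inv hw hd (abs_arg_le_four _)).mul
      ((isGateGenerator_phase i).implementable_inv hw hd (abs_arg_le_four _))).mul
      ((isGateGenerator_beamSplitter hik).implementable_inv hw hd
        (by rw [abs_neg]; exact abs_arg_le_four _))
  · exact ((isGateGenerator_beamSplitter hik).supportedOn _).mul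
      ((hps.mono (by simp)).mul (hqs.mono (by simp)))
  · have hk : ((p * q).1 *ᵥ v) k = ‖v k‖ := by
      rw [UnitaryGroup.mul_val, ← mulVec_mulVec, hps.1 _ k (by simpa using hik.symm),
        phase_arg_mulVec]
    have hi : ((p * q).1 *ᵥ v) i = ‖v i‖ := by
      have hqi := hqs.1 v i (by simpa using hik)
      have := phase_arg_mulVec i (q.1 *ᵥ v)
      rw [hqi] at this
      rw [UnitaryGroup.mul_val, ← mulVec_mulVec, this]
    rw [UnitaryGroup.mul_val, ← mulVec_mulVec, beamSplitter_mulVec hik, hi, hk]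
    have hc := Complex.norm_mul_cos_arg z
    have hs := Complex.norm_mul_sin_arg z
    rw [show z.re = ‖v k‖ from rfl] at hc
    rw [show z.im = ‖v i‖ from rfl] at hs
    rw [← hc, ← hs, Complex.ofReal_neg, Complex.cos_neg, Complex.sin_neg]
    push_cast
    ring

-- Each entry is rotated into mode `k`. A rotation touches only its own two modes, so cleared
-- entries stay zero. The cost is recorded for `g⁻¹` because that is the factor in the final
-- decomposition.
open Matrix in
theorem exists_implementable_clear {w d N : ℕ} (hw : 2 ≤ w) (hd : 2 ≤ d) (k : Fin N)
    (s : Finset (Fin N)) (hk : k ∉ s) (v : Fin N → ℂ) (hv : ∀ j ∉ insert k s, v j = 0) :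
    ∃ g : unitaryGroup (Fin N) ℂ, Implementable w d (12 * s.card) g⁻¹ ∧
      SupportedOn (insert k s) g ∧ ∀ j, j ≠ k → (g.1 *ᵥ v) j = 0 := by
  induction s using Finset.induction_on generalizing v with
  | empty =>
    refine ⟨1, ?_, supportedOn_one _, fun j hj => ?_⟩
    · rw [inv_one]
      exact implementable_one w d
    · simpa using hv j (by simpa using hj)
  | insert i s his ih =>
    have hki : i ≠ k := fun h => hk (by simp [h])
    obtain ⟨g, hg, hgs, hgi⟩ := exists_implementable_clear_entry hw hd hki v
    obtain ⟨g', hg', hgs', hgv'⟩ := ih (fun h => hk (Finset.mem_insert_of_mem h)) (g.1 *ᵥ v) (by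
      intro j hj
      by_cases hji : j = i
      · rw [hji, hgi]
      · simp only [Finset.mem_insert, not_or] at hj
        rw [hgs.1 v j (by simp [hji, hj.1]), hv j (by simp [hji, hj.1, hj.2])])
    refine ⟨g' * g, ?_, ?_, ?_⟩
    · rw [_root_.mul_inv_rev, Finset.card_insert_of_notMem his]
      exact (hg.mul hg').mono (by omega)
    · refine (hgs'.mono ?_).mul (hgs.mono ?_)
      · exact Finset.insert_subset_insert _ (Finset.subset_insert _ _)
      · intro j
        simp only [Finset.mem_insert, Finset.mem_singleton]
        tauto
    · intro j hj
      rw [UnitaryGroup.mul_val, ← mulVec_mulVec, hgv' j hj]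

open Matrix in
theorem unitary_entry {N : ℕ} (u : unitaryGroup (Fin N) ℂ) (j k : Fin N) :
    ∑ l, (starRingEnd ℂ) (u.1 l j) * u.1 l k = if j = k then 1 else 0 := by
  have := congrFun₂ (mem_unitaryGroup_iff'.1 u.2) j k
  simpa [mul_apply, one_apply] using this

open Matrix in
/-- Decomposition of a unitary matrix into Givens rotations and phases. -/
theorem implementable_of_fixes_compl {w d N : ℕ} (hw : 2 ≤ w) (hd : 2 ≤ d) (s : Finset (Fin N))
    (u : unitaryGroup (Fin N) ℂ) (hu : ∀ j ∉ s, u.1 *ᵥ Pi.single j 1 = Pi.single j 1) :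
    Implementable w d (16 * N * s.card) u := by
  induction s using Finset.induction_on generalizing u with
  | empty =>
    have : u = 1 := by
      refine Subtype.ext (Matrix.ext_of_mulVec_single fun j => ?_)
      rw [hu j (by simp), UnitaryGroup.one_val, one_mulVec]
    rw [this]
    exact implementable_one w d
  | insert k s hk ih =>
    -- Column `k` is orthogonal to the columns outside `insert k s`, which are already basis
    -- vectors.
    have hcol : ∀ j ∉ insert k s, (u.1 *ᵥ Pi.single k 1) j = 0 := by
      intro j hj
      have hjk : j ≠ k := fun h => hj (by simp [h])
      have h1 := unitary_entry u j k
      have h2 : ∀ l, u.1 l j = (Pi.single j 1 : Fin N → ℂ) l := fun l => by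
        rw [← hu j hj]
        simp
      rw [if_neg hjk, Finset.sum_eq_single j] at h1
      · rw [h2] at h1
        simpa using h1
      · intro l _ hl
        simp [h2, hl]
      · simp
    obtain ⟨g, hg, hgs, hgk⟩ := exists_implementable_clear hw hd k s hk _ hcol
    set v := g.1 *ᵥ u.1 *ᵥ Pi.single k 1 with hv
    have hvl : ∀ l, (g * u).1 l k = v l := fun l => by
      rw [hv, mulVec_mulVec, UnitaryGroup.mul_val]
      simp
    -- It is the only nonzero entry of a unit column, so a single phase turns that column into the
    -- basis vector `e_k`.
    have hnorm : ‖v k‖ = 1 := by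
      have h1 := unitary_entry (g * u) k k
      rw [if_pos rfl, Finset.sum_eq_single k] at h1
      · rw [hvl, ← Complex.normSq_eq_conj_mul_self] at h1
        have h2 : Complex.normSq (v k) = 1 := by exact_mod_cast h1
        rw [Complex.normSq_eq_norm_sq] at h2
        exact (pow_eq_one_iff_of_nonneg (norm_nonneg _) two_ne_zero).1 h2
      · intro l _ hl
        rw [hvl, hgk l hl, mul_zero]
      · simp
    set p := (isGateGenerator_phase k).unitary (v k).arg with hp
    have hps : SupportedOn {k} p := IsGateGenerator.supportedOn _ _
    have himp := ih (p * (g * u)) (by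
      intro j hj
      rw [UnitaryGroup.mul_val, UnitaryGroup.mul_val, ← mulVec_mulVec, ← mulVec_mulVec]
      by_cases hjk : j = k
      · subst hjk
        funext l
        by_cases hl : l = j
        · subst hl
          rw [phase_arg_mulVec, hnorm]
          simp
        · rw [hps.1 _ l (by simpa using hl), ← hv, hgk l hl]
          simp [hl]
      · have hj' : j ∉ insert k s := by simp [hjk, hj]
        have h0 : ∀ l ∈ insert k s, (Pi.single j 1 : Fin N → ℂ) l = 0 := fun l hl =>
          Pi.single_eq_of_ne (ne_of_mem_of_not_mem hl hj') _
        rw [hu j hj', hgs.2 _ h0, hps.2 _ (by simpa using h0 k (by simp))])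
    have hdec : u = g⁻¹ * (p⁻¹ * (p * (g * u))) := by group
    rw [hdec]
    refine (hg.mul (((isGateGenerator_phase k).implementable_inv hw hd
      (abs_arg_le_four _)).mul himp)).mono ?_
    -- One column costs `12 |s| + 4`, at most `16 N` because `|s| + 1 ≤ N`.
    have hcard : (insert k s).card ≤ N := by simpa using Finset.card_le_univ (insert k s)
    rw [Finset.card_insert_of_notMem hk] at hcard ⊢
    have : 16 * N * (s.card + 1) = 16 * N * s.card + 16 * N := by ring
    omega

theorem implementable {w d N : ℕ} (hw : 2 ≤ w) (hd : 2 ≤ d)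
    (u : Matrix.unitaryGroup (Fin N) ℂ) : Implementable w d (16 * N ^ 2) u := by
  have := implementable_of_fixes_compl hw hd Finset.univ u (by simp)
  rwa [Finset.card_univ, Fintype.card_fin, mul_assoc, ← pow_two] at this

/-! ### Exact simulation and the asymptotic comparison -/

theorem withVacuum_zero {n : ℕ} (ψ : Fock n) : withVacuum 0 ψ = ψ := by
  ext x
  simp [withVacuum, withVacuumFun]

/-- Exact simulation of a quadratic Hamiltonian without ancillary modes. -/
theorem exists_circuit {w d n : ℕ} (hw : 2 ≤ w) (hd : 2 ≤ d) {α : Matrix (Fin n) (Fin n) ℂ}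
    (h : ∀ i j, α j i = (starRingEnd ℂ) (α i j)) (t : ℝ) :
    ∃ V : Circuit w d n, V.size ≤ 16 * n ^ 2 ∧ ∀ ψ,
      withVacuum V.anc (evolution (quadratic α).toEnd t ψ) = V.unitary (withVacuum V.anc ψ) := by
  obtain ⟨u, hu⟩ := exists_isModeEvolution h
  obtain ⟨L, hL, hLu⟩ := implementable hw hd (u t)
  refine ⟨⟨0, L⟩, hL, fun ψ => ?_⟩
  have hV : (⟨0, L⟩ : Circuit w d n).unitary = secondQuant (u t) := hLu
  rw [hV, hu.evolution_eq]
  exact (withVacuum_zero _).trans (congrArg _ (withVacuum_zero ψ).symm)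

end Bosonic

theorem theorem7
    -- constants of the bosonic gate model and of the classes of Hamiltonians
    (w d w' d' : ℕ) (hw : 2 ≤ w) (hd : 2 ≤ d) (hw' : 2 ≤ w') (hd' : 2 ≤ d')
    (τ : ℝ) (hτ : 1 < τ) (ε : ℝ) (hε : 0 < ε)
    (m : ℕ → ℕ) (hm : Bosonic.PolyBounded m)
    (α : (n : ℕ) → Matrix (Fin n) (Fin n) ℂ)
    (hherm : ∀ n i j, α n j i = (starRingEnd ℂ) (α n i j))
    (hbound : ∀ n i j, ‖α n i j‖ ≤ 1) :
    (∀ n, Bosonic.quadratic (α n) ∈ Bosonic.hamiltonianClass w' d' n) ∧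
    ∃ (G : ℕ → ℕ) (V : (n : ℕ) → ℝ → Bosonic.Circuit w d n),
      ((fun n => (G n : ℝ)) =O[Filter.atTop] fun n => (n : ℝ) ^ 2 * Real.log (τ ^ n)) ∧
      Bosonic.PolyBounded G ∧
      (∀ n, Bosonic.Simulates (V n) (Bosonic.quadratic (α n)) (Bosonic.sector n (m n))
        (τ ^ n) ε (G n)) ∧
      ((∃ c : ℝ, 0 < c ∧ ∀ᶠ n : ℕ in Filter.atTop,
          ENNReal.ofReal (c * (n * τ ^ n)) ≤
            ((Bosonic.noFastForwardingLine w d (Bosonic.hamiltonianClass w' d' n)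
              (Bosonic.sector n (m n)) (τ ^ n) ε : ℕ∞) : ENNReal)) →
        Bosonic.ExpFastForwards V (fun n => Bosonic.hamiltonianClass w' d' n)
          (fun n => Bosonic.quadratic (α n)) (fun n => Bosonic.sector n (m n))
          (fun n => τ ^ n) ε G) := by

  have hlog : 0 < Real.log τ := Real.log_pos hτ
  have hτ0 : 0 < τ := by linarith
  choose V hVsize hV using fun (n : ℕ) (t : ℝ) =>
    Bosonic.exists_circuit (w := w) (d := d) hw hd (hherm n) t
  have hmem : ∀ n, Bosonic.quadratic (α n) ∈ Bosonic.hamiltonianClass w' d' n := fun n =>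
    Bosonic.quadratic_mem_hamiltonianClass hw' hd' (hherm n) (hbound n)
  have hpoly : Bosonic.PolyBounded fun n => 16 * n ^ 2 :=
    ⟨16 * Polynomial.X ^ 2, fun n => by simp⟩
  have hsim : ∀ n, Bosonic.Simulates (V n) (Bosonic.quadratic (α n)) (Bosonic.sector n (m n))
      (τ ^ n) ε (16 * n ^ 2) := fun n t _ _ => ⟨hVsize n t, fun ψ _ _ => by
    rw [hV, sub_self, norm_zero]
    exact hε.le⟩
  refine ⟨hmem, fun n => 16 * n ^ 2, V, ?_, hpoly, hsim, ?_⟩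
  -- Since `log T = n log τ`, this constant turns the bound into `16 n³`, which dominates `16 n²`
  -- once `n ≥ 1`.
  · refine Asymptotics.IsBigO.of_bound (16 / Real.log τ) ?_
    filter_upwards [Filter.eventually_ge_atTop 1] with n hn
    have hn1 : (1 : ℝ) ≤ n := by exact_mod_cast hn
    rw [Real.log_pow, Real.norm_of_nonneg (by positivity), Real.norm_of_nonneg (by positivity)]
    push_cast
    have : 16 / Real.log τ * ((n : ℝ) ^ 2 * (n * Real.log τ)) = 16 * (n : ℝ) ^ 2 * n := by
      field_simp
    rw [this]
    exact le_mul_of_one_le_right (by positivity) hn1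
  · rintro ⟨c, hc, hline⟩
    refine ⟨⟨hmem, hsim, ?_⟩, hpoly, τ, hτ, ?_⟩
    -- The assumed lower bound on the line dominates the ratio by `16 n² / (c n τ^n) = (16 / c) n /
    -- τ^n`.
    · have hlim : Filter.Tendsto (fun n : ℕ => ENNReal.ofReal (16 / c * ((n : ℝ) ^ 1 / τ ^ n)))
          Filter.atTop (nhds 0) := by
        have := ((tendsto_pow_const_div_const_pow_of_one_lt 1 hτ).const_mul (16 / c))
        rw [mul_zero] at this
        simpa using ENNReal.tendsto_ofReal this
      refine tendsto_of_tendsto_of_tendsto_of_le_of_le' tendsto_const_nhds hlim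
        (Filter.Eventually.of_forall fun _ => zero_le) ?_
      filter_upwards [hline, Filter.eventually_ge_atTop 1] with n hn hn1
      have hn0 : (0 : ℝ) < n := by exact_mod_cast hn1
      have hpos : 0 < c * (n * τ ^ n) := by positivity
      refine (ENNReal.div_le_div_left hn _).trans (le_of_eq ?_)
      have h16 : ((16 * n ^ 2 : ℕ) : ℝ≥0∞) = ENNReal.ofReal (16 * (n : ℝ) ^ 2) := by
        rw [← ENNReal.ofReal_natCast]
        push_cast
        rfl
      rw [h16, ← ENNReal.ofReal_div_of_pos hpos]
      congr 1
      field_simp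
    -- For `n ≥ 1 / c` the factor `c n` is at least `1`, so `τ` itself serves as the exponential
    -- base.
    · obtain ⟨k, hk⟩ := exists_nat_ge (1 / c)
      filter_upwards [hline, Filter.eventually_ge_atTop k] with n hn hkn
      refine le_trans (ENNReal.ofReal_le_ofReal ?_) hn
      have hnk : 1 / c ≤ (n : ℝ) := hk.trans (by exact_mod_cast hkn)
      have h1 : 1 ≤ c * n := by rwa [div_le_iff₀' hc] at hnk
      calc τ ^ n = 1 * τ ^ n := (one_mul _).symm
        _ ≤ c * n * τ ^ n := by gcongr
        _ = c * (n * τ ^ n) := by ring
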